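/- **Setting.** There are $S\ge 1$ base stations (BSs) with $N$ antennas each, $K$ users, channels $\mathbf h_{s,k}\in\mathbb C^N$, $\mathbf H_{s,k}=\mathbf h_{s,k}\mathbf h_{s,k}^H$, noise powers $\sigma_{\mathrm c,k}^2>0$, $\sigma_{\mathrm r,s}^2>0$, SINR thresholds $\Gamma_k>0$, a power budget $P$, a threshold $\epsilon$, a number of samples $L$, a penalty factor $\mu\in\mathbb R$, reals $a^{(t)}_{s,k}$, and gains $\alpha_{s,s'}\in\mathbb C$. The angles $\theta_{\mathrm r,s},\theta_{\mathrm t,s}$ and the delays $\tau_{s,s'}$ are real functions of a target location in $\mathbb R^2$, differentiable at the given point $\mathbf p=(p_1,p_2)$; a superscript $(i)$ with a dot denotes $\partial/\partial p_i$ at $\mathbf p$. The BS selection $b_s\in[0,1]$ (in particular $b_s\in\{0,1\}$) is fixed, with $\sum_s(1-b_s)=1$. With $\mathbf a(\theta)=[1,e^{-j\pi\sin\theta},\dots,e^{-j(N-1)\pi\sin\theta}]^T$ put $\mathbf G_{s,s'}=\mathbf a(\theta_{\mathrm r,s})\mathbf a(\theta_{\mathrm t,s'})^H$, $\dot{\mathbf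 G}^{(i)}_{s,s'}=\dot{\mathbf a}^{(i)}(\theta_{\mathrm r,s})\mathbf a(\theta_{\mathrm t,s'})^H+\mathbf a(\theta_{\mathrm r,s})[\dot{\mathbf a}^{(i)}(\theta_{\mathrm t,s'})]^H$ and $\tilde{\mathbf G}^{(i)}_{s,s'}=\dot{\mathbf G}^{(i)}_{s,s'}-\dot\tau^{(i)}_{s,s'}\mathbf G_{s,s'}$. **Problem.** The variables are Hermitian $N\times N$ matrices $\mathbf W_{s,k},\widetilde{\mathbf W}_{s,k},\mathbf R_s$, a Hermitian $2\times2$ matrix $\mathbf J$, and reals $a_{s,k}$. Put $\mathbf Q_s=\sum_k\widetilde{\mathbf W}_{s,k}+\mathbf R_s$. For each $s$, with $s'_1<\dots<s'_{S-1}$ the BSs other than $s$, let $$(\mathbf F^{(s)}_{\mathbf p\mathbf p})_{ij}=\tfrac{2L}{\sigma_{\mathrm r,s}^2}\Re\,\mathrm{tr}\sum_{s'\ne s}|\alpha_{s,s'}|^2\tilde{\mathbf G}^{(j)}_{s,s'}\mathbf Q_{s'}[\tilde{\mathbf G}^{(i)}_{s,s'}]^H,\quad \mathbf F^{(s)}_{\mathbf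 p\boldsymbol\alpha}=\tfrac{2L}{\sigma_{\mathrm r,s}^2}\Re\{[1,j]\otimes\mathbf D^{(s)}\},\quad \mathbf F^{(s)}_{\boldsymbol\alpha\boldsymbol\alpha}=\tfrac{2L}{\sigma_{\mathrm r,s}^2}\mathbf I_2\otimes\mathbf E^{(s)},$$ where $\mathbf D^{(s)}_{i,m}=\alpha^*_{s,s'_m}\mathrm{tr}(\mathbf G_{s,s'_m}\mathbf Q_{s'_m}[\tilde{\mathbf G}^{(i)}_{s,s'_m}]^H)$ and $\mathbf E^{(s)}$ is diagonal with entries $\mathrm{tr}(\mathbf G_{s,s'_m}\mathbf Q_{s'_m}\mathbf G_{s,s'_m}^H)$. The subproblem is to minimize $$\sum_{s,k}\mathrm{tr}(\widetilde{\mathbf W}_{s,k})+\sum_s b_s\mathrm{tr}(\mathbf R_s)+\mu\sum_{s,k}\big((1-2a^{(t)}_{s,k})a_{s,k}+(a^{(t)}_{s,k})^2\big)$$ subject to $\mathbf W_{s,k}\succeq\mathbf 0$, $\mathbf R_s\succeq\mathbf 0$ and, for all $s,k$, - C1: $\sum_k\mathrm{tr}(\widetilde{\mathbf W}_{s,k})+b_s\mathrm{tr}(\mathbf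 R_s)\le P$; - C2a, C2b: $\mathbf J\succeq\mathbf 0$ is invertible and $\mathrm{tr}(\mathbf J^{-1})\le\epsilon$; - C2c: $\sum_s(1-b_s)\begin{bmatrix}\mathbf F^{(s)}_{\mathbf p\mathbf p}-\mathbf J&\mathbf F^{(s)}_{\mathbf p\boldsymbol\alpha}\\ [\mathbf F^{(s)}_{\mathbf p\boldsymbol\alpha}]^T&\mathbf F^{(s)}_{\boldsymbol\alpha\boldsymbol\alpha}\end{bmatrix}\succeq\mathbf 0$; - C3: $\frac1{\Gamma_k}\sum_s\mathrm{tr}(\mathbf H_{s,k}\widetilde{\mathbf W}_{s,k})-\sum_sb_s\mathrm{tr}(\mathbf H_{s,k}\mathbf R_s)-\sum_s\sum_{k'\ne k}\mathrm{tr}(\mathbf H_{s,k}\widetilde{\mathbf W}_{s,k'})\ge\sigma_{\mathrm c,k}^2$; - C4: $\sum_sa_{s,k}=1$; C6: $a_{s,k}\le b_s$; C7: $a_{s,k}\in\mathcal A$, where either $\mathcal A=\{0,1\}$ or $\mathcal A=[0,1]$; - C9: $\mathrm{rank}(\mathbf W_{s,k})\le1$; - C10: $\widetilde{\mathbf W}_{s,k}\preceq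 a_{s,k}P\mathbf I$, $\ \widetilde{\mathbf W}_{s,k}\succeq\mathbf W_{s,k}-(1-a_{s,k})P\mathbf I$, $\ \widetilde{\mathbf W}_{s,k}\preceq\mathbf W_{s,k}$, $\ \widetilde{\mathbf W}_{s,k}\succeq\mathbf 0$. **Theorem 1.** For either choice of $\mathcal A$, if the relaxed problem (all constraints except C9) is feasible, then it has an optimal solution with $\mathrm{rank}(\mathbf W_{s,k})=1$ for all $s,k$. In particular this solution is also optimal for the problem with C9, so the relaxation is tight. -/

import Mathlib

open scoped Matrix Kronecker ComplexOrder

noncomputable section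

namespace ISAC

/-- The given data of the beamforming subproblem, for `M + 1` base stations (BSs) with `N`
antennas each and `K` single-antenna users. The angles and delays are functions of the planar
target location, so that every geometry of the network is covered. -/
structure Network (M K N : ℕ) where
  /-- channel `h_{s,k}` from BS `s` to user `k` -/
  h : Fin (M + 1) → Fin K → Fin N → ℂ
  /-- noise standard deviation at user `k` -/
  σc : Fin K → ℝ
  /-- noise standard deviation at BS `s` when receiving -/
  σr : Fin (M + 1) → ℝ
  /-- SINR threshold of user `k` -/
  Γ : Fin K → ℝ
  /-- power budget of each BS -/
  P : ℝ
  /-- threshold for the Cramér-Rao bound -/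
  ε : ℝ
  /-- number of radar samples -/
  L : ℕ
  /-- `α s s'`: complex gain of the link from BS `s'` via the target to BS `s` -/
  α : Fin (M + 1) → Fin (M + 1) → ℂ
  /-- target location -/
  p : Fin 2 → ℝ
  /-- angle of arrival at BS `s`, as a function of the target location -/
  θr : Fin (M + 1) → (Fin 2 → ℝ) → ℝ
  /-- angle of departure at BS `s`, as a function of the target location -/
  θt : Fin (M + 1) → (Fin 2 → ℝ) → ℝ
  /-- `τ s s'`: delay from BS `s'` via the target to BS `s`, as a function of the location -/
  τ : Fin (M + 1) → Fin (M + 1) → (Fin 2 → ℝ) → ℝ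
  /-- the fixed BS selection: `b s = 1` transmitting, `b s = 0` receiving -/
  b : Fin (M + 1) → ℝ
  /-- penalty factor -/
  μ : ℝ
  /-- association `a^{(t)}` of the previous iteration -/
  aPrev : Fin (M + 1) → Fin K → ℝ

/-- The optimization variables `W_{s,k}`, `W̃_{s,k}`, `R_s`, `J`, `a_{s,k}`. -/
structure Vars (M K N : ℕ) where
  W : Fin (M + 1) → Fin K → Matrix (Fin N) (Fin N) ℂ
  Wt : Fin (M + 1) → Fin K → Matrix (Fin N) (Fin N) ℂ
  R : Fin (M + 1) → Matrix (Fin N) (Fin N) ℂ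
  J : Matrix (Fin 2) (Fin 2) ℂ
  a : Fin (M + 1) → Fin K → ℝ

/-- Steering vector `[1, e^{-jπ sin θ}, …, e^{-j(N-1)π sin θ}]` of a uniform linear array. -/
def steering (N : ℕ) (θ : ℝ) : Fin N → ℂ :=
  fun n => Complex.exp (-(Complex.I * (n : ℕ) * Real.pi * Real.sin θ))

/-- Derivative of the steering vector `a(θ(q))` with respect to the coordinate `q_i`, at `q = p`. -/
def steeringDeriv (N : ℕ) (θ : (Fin 2 → ℝ) → ℝ) (p : Fin 2 → ℝ) (i : Fin 2) : Fin N → ℂ :=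
  fun n => lineDeriv ℝ (fun q => steering N (θ q) n) p (Pi.single i 1)

namespace Network

variable {M K N : ℕ} (net : Network M K N)

/-- `H_{s,k} = h_{s,k} h_{s,k}^H`. -/
def H (s : Fin (M + 1)) (k : Fin K) : Matrix (Fin N) (Fin N) ℂ :=
  Matrix.vecMulVec (net.h s k) (star (net.h s k))

/-- Target response matrix `G_{s,s'} = a(θ_{r,s}) a(θ_{t,s'})^H`. -/
def G (s s' : Fin (M + 1)) : Matrix (Fin N) (Fin N) ℂ :=
  Matrix.vecMulVec (steering N (net.θr s net.p)) (star (steering N (net.θt s' net.p)))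

/-- The derivative of `G_{s,s'}` with respect to `p_i`. -/
def Gdot (i : Fin 2) (s s' : Fin (M + 1)) : Matrix (Fin N) (Fin N) ℂ :=
  Matrix.vecMulVec (steeringDeriv N (net.θr s) net.p i) (star (steering N (net.θt s' net.p))) +
  Matrix.vecMulVec (steering N (net.θr s net.p)) (star (steeringDeriv N (net.θt s') net.p i))

/-- `G̃^{(i)}_{s,s'} = Ġ^{(i)}_{s,s'} - τ̇^{(i)}_{s,s'} G_{s,s'}`. -/
def Gtilde (i : Fin 2) (s s' : Fin (M + 1)) : Matrix (Fin N) (Fin N) ℂ :=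
  net.Gdot i s s' - ((lineDeriv ℝ (net.τ s s') net.p (Pi.single i 1) : ℝ) : ℂ) • net.G s s'

/-- Transmit covariance `∑_k W̃_{s,k} + R_s` of a transmitting BS. -/
def cov (x : Vars M K N) (s : Fin (M + 1)) : Matrix (Fin N) (Fin N) ℂ :=
  ∑ k, x.Wt s k + x.R s

/-- The location block of the Fisher information matrix when BS `s` receives. As `m` runs over
`Fin M`, `s.succAbove m` runs in increasing order over the BSs other than `s`. -/
def Fpp (x : Vars M K N) (s : Fin (M + 1)) : Matrix (Fin 2) (Fin 2) ℝ :=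
  Matrix.of fun i j => 2 * (net.L : ℝ) / net.σr s ^ 2 *
    (Matrix.trace (∑ m : Fin M, ((‖net.α s (s.succAbove m)‖ ^ 2 : ℝ) : ℂ) •
      (net.Gtilde j s (s.succAbove m) * cov x (s.succAbove m) *
        (net.Gtilde i s (s.succAbove m))ᴴ))).re

/-- The entries `D_{i,s'}`. -/
def D (x : Vars M K N) (s : Fin (M + 1)) : Matrix (Fin 2) (Fin M) ℂ :=
  Matrix.of fun i m => star (net.α s (s.succAbove m)) *
    Matrix.trace (net.G s (s.succAbove m) * cov x (s.succAbove m) *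
      (net.Gtilde i s (s.succAbove m))ᴴ)

/-- The location/gain block `(2L/σ²) Re([1, j] ⊗ D)`; in the column index `(c, m)`, `c = 0` stands
for the real and `c = 1` for the imaginary part of the gain. -/
def Fpα (x : Vars M K N) (s : Fin (M + 1)) : Matrix (Fin 2) (Fin 2 × Fin M) ℝ :=
  Matrix.of fun i cm => 2 * (net.L : ℝ) / net.σr s ^ 2 *
    ((![1, Complex.I] : Fin 2 → ℂ) cm.1 * net.D x s i cm.2).re

/-- The gain block `(2L/σ²) I₂ ⊗ E` with `E` diagonal (its entries are real). -/
def Fαα (x : Vars M K N) (s : Fin (M + 1)) : Matrix (Fin 2 × Fin M) (Fin 2 × Fin M) ℝ :=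
  (2 * (net.L : ℝ) / net.σr s ^ 2) • ((1 : Matrix (Fin 2) (Fin 2) ℝ) ⊗ₖ
    Matrix.diagonal fun m : Fin M =>
      (Matrix.trace (net.G s (s.succAbove m) * cov x (s.succAbove m) *
        (net.G s (s.succAbove m))ᴴ)).re)

/-- The block matrix of the Schur-complement form of the Cramér-Rao constraint. -/
def crlbBlock (x : Vars M K N) (s : Fin (M + 1)) :
    Matrix (Fin 2 ⊕ (Fin 2 × Fin M)) (Fin 2 ⊕ (Fin 2 × Fin M)) ℂ :=
  Matrix.fromBlocks ((net.Fpp x s).map Complex.ofReal - x.J) ((net.Fpα x s).map Complex.ofReal)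
    ((net.Fpα x s)ᵀ.map Complex.ofReal) ((net.Fαα x s).map Complex.ofReal)

/-- Feasibility for the subproblem without the rank constraint. The set `𝒜` is the range allowed
for the association variables: `{0, 1}`, or its continuous relaxation `[0, 1]`. -/
structure RelaxedFeasible (𝒜 : Set ℝ) (x : Vars M K N) : Prop where
  W_psd : ∀ s k, (x.W s k).PosSemidef
  R_psd : ∀ s, (x.R s).PosSemidef
  C1 : ∀ s, ∑ k, (x.Wt s k).trace.re + net.b s * (x.R s).trace.re ≤ net.P
  C2a : IsUnit x.J.det ∧ (x.J⁻¹).trace.re ≤ net.ε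
  C2b : x.J.PosSemidef
  C2c : (∑ s, ((1 - net.b s : ℝ) : ℂ) • net.crlbBlock x s).PosSemidef
  C3 : ∀ k, net.σc k ^ 2 ≤ 1 / net.Γ k * ∑ s, (net.H s k * x.Wt s k).trace.re
      - ∑ s, net.b s * (net.H s k * x.R s).trace.re
      - ∑ s, ∑ k' ∈ Finset.univ.erase k, (net.H s k * x.Wt s k').trace.re
  C4 : ∀ k, ∑ s, x.a s k = 1
  C6 : ∀ s k, x.a s k ≤ net.b s
  C7 : ∀ s k, x.a s k ∈ 𝒜
  C10a : ∀ s k, (((x.a s k * net.P : ℝ) : ℂ) • (1 : Matrix (Fin N) (Fin N) ℂ)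
      - x.Wt s k).PosSemidef
  C10b : ∀ s k, (x.Wt s k - (x.W s k
      - (((1 - x.a s k) * net.P : ℝ) : ℂ) • (1 : Matrix (Fin N) (Fin N) ℂ))).PosSemidef
  C10c : ∀ s k, (x.W s k - x.Wt s k).PosSemidef
  C10d : ∀ s k, (x.Wt s k).PosSemidef

/-- Feasible set of the rank-relaxed subproblem. -/
def relaxedSet (𝒜 : Set ℝ) : Set (Vars M K N) := {x | net.RelaxedFeasible 𝒜 x}

/-- Feasible set of the subproblem with the rank constraint `rank W_{s,k} ≤ 1`. -/
def rankSet (𝒜 : Set ℝ) : Set (Vars M K N) :=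
  {x | net.RelaxedFeasible 𝒜 x ∧ ∀ s k, (x.W s k).rank ≤ 1}

/-- The penalized transmit power. -/
def objective (x : Vars M K N) : ℝ :=
  ∑ s, ∑ k, (x.Wt s k).trace.re + ∑ s, net.b s * (x.R s).trace.re
    + net.μ * ∑ s, ∑ k, ((1 - 2 * net.aPrev s k) * x.a s k + net.aPrev s k ^ 2)

end Network

end ISAC

end

/-!
A minimizer exists by compactness: all the variables are bounded except the sensing covariances of
the purely receiving BSs, and those can be switched off.

A minimizer is made rank one by replacing each `W̃ = W̃_{s,k}` by `W̃ h hᴴ W̃ / (hᴴ W̃ h)`, where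
`h = h_{s,k}`, and moving the positive semidefinite remainder into `R_s`. This changes neither the
transmit covariance, hence not the Cramér-Rao constraint, nor the power that user `k` receives from
its own stream; because `b_s ≤ 1`, it increases neither the transmit power nor the interference.
Then `W_{s,k}` can be taken equal to the new `W̃_{s,k}`, unless `W̃ h = 0`. In that case another BS
serves user `k`, so `a_{s,k} < 1`, and the big-M constraints leave room for a small `W_{s,k}` of
rank one.
-/

namespace ISAC

open Matrix RCLike

section Matrix

theorem rank_vecMulVec_of_ne_zero {m n K : Type*} [Fintype n] [Field K] {u : m → K} {v : n → K}
    (hu : u ≠ 0) (hv : v ≠ 0) : (vecMulVec u v).rank = 1 := by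
  classical
  refine le_antisymm (rank_vecMulVec_le u v) (Nat.one_le_iff_ne_zero.2 fun h => ?_)
  rw [rank, Submodule.finrank_eq_zero, LinearMap.range_eq_bot, ← toLin'_apply',
    LinearEquiv.map_eq_zero_iff] at h
  obtain ⟨i, hi⟩ := Function.ne_iff.1 hu
  obtain ⟨j, hj⟩ := Function.ne_iff.1 hv
  exact mul_ne_zero hi hj (congrFun₂ h i j)

variable {𝕜 n : Type*} [RCLike 𝕜]

theorem norm_apply_sq_le {A : Matrix n n 𝕜} (hA : A.PosSemidef) (i j : n) :
    ‖A i j‖ ^ 2 ≤ re (A i i) * re (A j j) := by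
  have hdet : 0 ≤ A i i * A j j - A i j * A j i := by
    simpa only [det_fin_two, submatrix_apply, cons_val_zero, cons_val_one] using
      (hA.submatrix ![i, j]).det_nonneg
  rw [← hA.isHermitian.apply j i, star_def, mul_conj] at hdet
  have him (l : n) : im (A l l) = 0 := (nonneg_iff.1 hA.diag_nonneg).2
  have hre := (nonneg_iff.1 hdet).1
  rw [map_sub, mul_re, him i, zero_mul, sub_zero, ← ofReal_pow, ofReal_re] at hre
  exact sub_nonneg.1 hre

theorem isClosed_setOf_posSemidef [Finite n] : IsClosed {A : Matrix n n 𝕜 | A.PosSemidef} := by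
  cases nonempty_fintype n
  simp only [posSemidef_iff_dotProduct_mulVec, IsHermitian, Set.ofPred_and, Set.ofPred_forall]
  refine (isClosed_eq (by fun_prop) continuous_id).inter (isClosed_iInter fun x => ?_)
  exact isClosed_le continuous_const (by fun_prop)

variable [Fintype n]

theorem re_trace_nonneg {A : Matrix n n 𝕜} (hA : A.PosSemidef) : 0 ≤ re A.trace :=
  (nonneg_iff.1 hA.trace_nonneg).1

theorem re_trace_mono {A B : Matrix n n 𝕜} (hBA : (A - B).PosSemidef) :
    re B.trace ≤ re A.trace := by
  rw [← sub_nonneg, ← map_sub, ← trace_sub]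
  exact re_trace_nonneg hBA

theorem re_trace_pos {A : Matrix n n 𝕜} (hA : A.PosSemidef) (hA0 : A ≠ 0) : 0 < re A.trace :=
  (pos_iff.1 (hA.trace_nonneg.lt_of_ne' (hA.trace_eq_zero_iff.not.2 hA0))).1

theorem norm_apply_le_re_trace {A : Matrix n n 𝕜} (hA : A.PosSemidef) (i j : n) :
    ‖A i j‖ ≤ re A.trace := by
  have hdiag (l : n) : 0 ≤ re (A l l) := (nonneg_iff.1 hA.diag_nonneg).1
  have hle (l : n) : re (A l l) ≤ re A.trace := by
    rw [trace, map_sum]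
    exact Finset.single_le_sum (f := fun l => re (A l l)) (fun l _ => hdiag l) (Finset.mem_univ l)
  refine le_of_sq_le_sq ?_ (re_trace_nonneg hA)
  calc ‖A i j‖ ^ 2 ≤ re (A i i) * re (A j j) := norm_apply_sq_le hA i j
    _ ≤ re A.trace ^ 2 := by
      rw [sq]
      exact mul_le_mul (hle i) (hle j) (hdiag j) (re_trace_nonneg hA)

variable (𝕜 n) in
/-- The positive semidefinite matrices of trace at most `c`: the compact sets in which the
optimization variables are confined. -/
def psdTraceLE (c : ℝ) : Set (Matrix n n 𝕜) := {A | A.PosSemidef ∧ re A.trace ≤ c}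

theorem zero_mem_psdTraceLE_zero : (0 : Matrix n n 𝕜) ∈ psdTraceLE 𝕜 n 0 :=
  ⟨.zero, by simp⟩

theorem isCompact_psdTraceLE (c : ℝ) : IsCompact (psdTraceLE 𝕜 n c) := by
  have hbox : IsCompact (Set.univ.pi fun _ : n => Set.univ.pi fun _ : n =>
      Metric.closedBall (0 : 𝕜) c) :=
    isCompact_univ_pi fun _ => isCompact_univ_pi fun _ => isCompact_closedBall 0 c
  refine hbox.of_isClosed_subset ?_ fun A hA i _ j _ => ?_
  · exact isClosed_setOf_posSemidef.inter
      (isClosed_le (continuous_re.comp (by fun_prop)) continuous_const)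
  · exact mem_closedBall_zero_iff.2 ((norm_apply_le_re_trace hA.1 i j).trans hA.2)

-- The inverses range over a compact set, and projecting along a compact factor is a closed map.
theorem isClosed_setOf_posSemidef_re_trace_inv_le [DecidableEq n] (c : ℝ) :
    IsClosed {A : Matrix n n 𝕜 | A.PosSemidef ∧ IsUnit A.det ∧ re A⁻¹.trace ≤ c} := by
  have : CompactSpace (psdTraceLE 𝕜 n c) := isCompact_iff_compactSpace.1 (isCompact_psdTraceLE c)
  let graph : Set (Matrix n n 𝕜 × psdTraceLE 𝕜 n c) := {p | p.1.PosSemidef ∧ p.1 * p.2 = 1}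
  have hgraph : IsClosed graph :=
    (isClosed_setOf_posSemidef.preimage continuous_fst).inter
      (isClosed_eq (by fun_prop) continuous_const)
  convert isClosedMap_fst_of_compactSpace _ hgraph
  ext A
  constructor
  · rintro ⟨hA, hunit, htr⟩
    exact ⟨(A, ⟨A⁻¹, hA.inv, htr⟩), ⟨hA, mul_nonsing_inv A hunit⟩, rfl⟩
  · rintro ⟨⟨_, B, hB⟩, ⟨hA, hAB⟩, rfl⟩
    exact ⟨hA, isUnit_det_of_right_inverse hAB, by rw [inv_eq_right_inv hAB]; exact hB.2⟩

theorem exists_posSemidef_rank_eq_one_le_smul_one [DecidableEq n] [Nonempty n] {c : 𝕜}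
    (hc : 0 < c) :
    ∃ A : Matrix n n 𝕜, A.PosSemidef ∧ A.rank = 1 ∧ (c • (1 : Matrix n n 𝕜) - A).PosSemidef := by
  obtain ⟨i⟩ := ‹Nonempty n›
  have hrank : diagonal (Pi.single i c) = vecMulVec (Pi.single i c) (Pi.single i 1) := by
    rw [diagonal_single, ← mul_one c, ← smul_eq_mul, ← smul_single,
      single_eq_single_vecMulVec_single, ← smul_vecMulVec, ← Pi.single_smul]
  refine ⟨diagonal (Pi.single i c), .diagonal (Pi.single_nonneg.2 hc.le), ?_, ?_⟩
  · rw [hrank]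
    exact rank_vecMulVec_of_ne_zero (by simpa using hc.ne') (by simp)
  · rw [smul_one_eq_diagonal, diagonal_sub]
    refine .diagonal fun j => ?_
    rcases eq_or_ne j i with rfl | hj
    · simp
    · simp [hj, hc.le]

/-- The matrix `A h hᴴ A / (hᴴ A h)` of rank one, which extracts from a covariance `A` the part
that is seen through the channel `h`. If `hᴴ A h = 0`, then it is `0`, because `0⁻¹ = 0`. -/
def rankOneAlong (A : Matrix n n 𝕜) (h : n → 𝕜) : Matrix n n 𝕜 :=
  (star h ⬝ᵥ A *ᵥ h)⁻¹ • vecMulVec (A *ᵥ h) (star (A *ᵥ h))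

variable {A : Matrix n n 𝕜}

theorem rankOneAlong_of_mulVec_eq_zero {h : n → 𝕜} (hAh : A *ᵥ h = 0) :
    rankOneAlong A h = 0 := by
  simp [rankOneAlong, hAh]

theorem rank_rankOneAlong (hA : A.PosSemidef) {h : n → 𝕜} (hAh : A *ᵥ h ≠ 0) :
    (rankOneAlong A h).rank = 1 := by
  have hd : star h ⬝ᵥ A *ᵥ h ≠ 0 := (hA.dotProduct_mulVec_zero_iff h).not.2 hAh
  rw [rankOneAlong, ← smul_vecMulVec]
  exact rank_vecMulVec_of_ne_zero (smul_ne_zero (inv_ne_zero hd) hAh) (star_ne_zero.2 hAh)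

theorem posSemidef_rankOneAlong (hA : A.PosSemidef) (h : n → 𝕜) :
    (rankOneAlong A h).PosSemidef :=
  (posSemidef_vecMulVec_self_star _).smul (inv_nonneg.2 (hA.dotProduct_mulVec_nonneg h))

theorem star_mulVec_dotProduct (hA : A.IsHermitian) (h : n → 𝕜) :
    star (A *ᵥ h) ⬝ᵥ h = star h ⬝ᵥ A *ᵥ h := by
  rw [star_mulVec, hA.eq, ← dotProduct_mulVec]

theorem dotProduct_rankOneAlong_mulVec (hA : A.IsHermitian) (h : n → 𝕜) :
    star h ⬝ᵥ rankOneAlong A h *ᵥ h = star h ⬝ᵥ A *ᵥ h := by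
  rw [rankOneAlong, smul_mulVec, vecMulVec_mulVec, star_mulVec_dotProduct hA, dotProduct_smul,
    op_smul_eq_smul, dotProduct_smul, smul_eq_mul, smul_eq_mul, ← mul_assoc, inv_mul_mul_self]

-- With `T = 1 - d⁻¹ h (A h)ᴴ` and `d = hᴴ A h`, the difference is the congruent matrix `Tᴴ A T`.
theorem posSemidef_sub_rankOneAlong (hA : A.PosSemidef) (h : n → 𝕜) :
    (A - rankOneAlong A h).PosSemidef := by
  classical
  set v := A *ᵥ h with hv
  set d := star h ⬝ᵥ v
  have hvh : star v ⬝ᵥ h = d := star_mulVec_dotProduct hA.isHermitian h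
  have hvA : star h ᵥ* A = star v := by rw [hv, star_mulVec, hA.isHermitian.eq]
  have hdstar : star d = d := (IsSelfAdjoint.of_nonneg (hA.dotProduct_mulVec_nonneg h)).star_eq
  have hT : (1 - d⁻¹ • vecMulVec h (star v))ᴴ = 1 - d⁻¹ • vecMulVec v (star h) := by
    rw [conjTranspose_sub, conjTranspose_smul, conjTranspose_vecMulVec, star_star, star_inv₀,
      hdstar, conjTranspose_one]
  have hdd : d⁻¹ * d⁻¹ * d = d⁻¹ := by simpa only [inv_inv] using mul_self_mul_inv d⁻¹
  have hcongr : A - rankOneAlong A h =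
      (1 - d⁻¹ • vecMulVec h (star v))ᴴ * A * (1 - d⁻¹ • vecMulVec h (star v)) := by
    rw [hT, sub_mul, one_mul, smul_mul_assoc, vecMulVec_mul, hvA, mul_sub, mul_one,
      mul_smul_comm, sub_mul, smul_mul_assoc, vecMulVec_mul_vecMulVec, mul_vecMulVec, ← hv, hvh,
      vecMulVec_smul, smul_sub, smul_smul, smul_smul, hdd, sub_self, sub_zero]
    rfl
  rw [hcongr]
  exact hA.conjTranspose_mul_mul_same _

end Matrix

theorem sum_add_mul_map_add_sum_sub_le {ι V S : Type*} [Fintype ι] [AddCommGroup V] [Ring S]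
    [LinearOrder S] [IsStrictOrderedRing S] (φ : V →+ S) {b : S} (hb : b ≤ 1) {A B : ι → V} (R : V)
    {T : Finset ι} (hle : ∀ k ∈ T, φ (B k) ≤ φ (A k)) (heq : ∀ k ∉ T, φ (B k) = φ (A k)) :
    ∑ k ∈ T, φ (B k) + b * φ (R + ∑ k, (A k - B k)) ≤ ∑ k ∈ T, φ (A k) + b * φ R := by
  have hmoved : φ (∑ k, (A k - B k)) = ∑ k ∈ T, (φ (A k) - φ (B k)) := by
    simp only [map_sum, map_sub]
    exact (Finset.sum_subset T.subset_univ fun k _ hk => sub_eq_zero.2 (heq k hk).symm).symm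
  have hnonneg : 0 ≤ ∑ k ∈ T, (φ (A k) - φ (B k)) :=
    Finset.sum_nonneg fun k hk => sub_nonneg.2 (hle k hk)
  calc ∑ k ∈ T, φ (B k) + b * φ (R + ∑ k, (A k - B k))
      = ∑ k ∈ T, φ (B k) + (b * φ R + b * ∑ k ∈ T, (φ (A k) - φ (B k))) := by
        rw [map_add, hmoved, mul_add]
    _ ≤ ∑ k ∈ T, φ (B k) + (b * φ R + ∑ k ∈ T, (φ (A k) - φ (B k))) := by
        gcongr
        exact mul_le_of_le_one_left hnonneg hb
    _ = ∑ k ∈ T, φ (A k) + b * φ R := by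
        rw [Finset.sum_sub_distrib]
        abel

/-- The transmit power `Re tr A` of a covariance `A`, as an additive function. -/
def txPower (N : ℕ) : Matrix (Fin N) (Fin N) ℂ →+ ℝ :=
  Complex.reAddGroupHom.comp (traceAddMonoidHom (Fin N) ℂ)

theorem posSemidef_ofReal_smul_one {c : ℝ} (hc : 0 ≤ c) (N : ℕ) :
    ((c : ℂ) • (1 : Matrix (Fin N) (Fin N) ℂ)).PosSemidef :=
  PosSemidef.one.smul (Complex.zero_le_real.2 hc)

theorem re_trace_ofReal_smul_one (c : ℝ) (N : ℕ) :
    ((c : ℂ) • (1 : Matrix (Fin N) (Fin N) ℂ)).trace.re = c * N := by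
  rw [trace_smul, trace_one, Fintype.card_fin, smul_eq_mul, Complex.re_ofReal_mul,
    Complex.natCast_re]

namespace Network

variable {M K N : ℕ} (net : Network M K N)

/-- The power that user `k` receives from BS `s`, as an additive function of the transmit
covariance. -/
def rxPower (s : Fin (M + 1)) (k : Fin K) : Matrix (Fin N) (Fin N) ℂ →+ ℝ :=
  Complex.reAddGroupHom.comp <|
    (traceAddMonoidHom (Fin N) ℂ).comp <| AddMonoidHom.mulLeft (net.H s k)

theorem rxPower_eq_re_dotProduct (s : Fin (M + 1)) (k : Fin K) (A : Matrix (Fin N) (Fin N) ℂ) :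
    net.rxPower s k A = (star (net.h s k) ⬝ᵥ A *ᵥ net.h s k).re := by
  rw [dotProduct_mulVec, dotProduct_comm, ← trace_vecMulVec, ← vecMulVec_mul]
  rfl

variable {net}

theorem rxPower_nonneg {A : Matrix (Fin N) (Fin N) ℂ} (hA : A.PosSemidef) (s : Fin (M + 1))
    (k : Fin K) : 0 ≤ net.rxPower s k A := by
  rw [rxPower_eq_re_dotProduct]
  exact hA.re_dotProduct_nonneg _

theorem rxPower_mono {A B : Matrix (Fin N) (Fin N) ℂ} (hBA : (A - B).PosSemidef)
    (s : Fin (M + 1)) (k : Fin K) : net.rxPower s k B ≤ net.rxPower s k A := by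
  rw [← sub_nonneg, ← map_sub]
  exact rxPower_nonneg hBA s k

variable {𝒜 : Set ℝ} {x : Vars M K N}

namespace RelaxedFeasible

theorem trace_Wt_le_a_mul (hx : net.RelaxedFeasible 𝒜 x) (s : Fin (M + 1)) (k : Fin K) :
    (x.Wt s k).trace.re ≤ x.a s k * (net.P * N) := by
  rw [← mul_assoc, ← re_trace_ofReal_smul_one]
  exact re_trace_mono (hx.C10a s k)

theorem trace_W_le (hx : net.RelaxedFeasible 𝒜 x) (s : Fin (M + 1)) (k : Fin K) :
    (x.W s k).trace.re ≤ net.P * N := by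
  have hC10b : (x.W s k - (((1 - x.a s k) * net.P : ℝ) : ℂ) • 1).trace.re ≤ (x.Wt s k).trace.re :=
    re_trace_mono (hx.C10b s k)
  rw [trace_sub, Complex.sub_re, re_trace_ofReal_smul_one] at hC10b
  linarith [hx.trace_Wt_le_a_mul s k]

theorem trace_Wt_le (hx : net.RelaxedFeasible 𝒜 x) (s : Fin (M + 1)) (k : Fin K) :
    (x.Wt s k).trace.re ≤ net.P * N :=
  (re_trace_mono (hx.C10c s k)).trans (hx.trace_W_le s k)

theorem trace_R_le (hx : net.RelaxedFeasible 𝒜 x) {s : Fin (M + 1)} (hb : 0 < net.b s) :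
    (x.R s).trace.re ≤ net.P / net.b s := by
  rw [le_div_iff₀' hb]
  have hWt : 0 ≤ ∑ k, (x.Wt s k).trace.re :=
    Finset.sum_nonneg fun k _ => re_trace_nonneg (hx.C10d s k)
  linarith [hx.C1 s]

theorem trace_J_le (hx : net.RelaxedFeasible 𝒜 x) (hb_sum : ∑ s, (1 - net.b s) = 1) :
    x.J.trace.re ≤ ∑ s, (1 - net.b s) * (net.Fpp x s).trace := by
  have htrace (s) : (net.crlbBlock x s).toBlocks₁₁.trace.re =
      (net.Fpp x s).trace - x.J.trace.re := by
    rw [crlbBlock, toBlocks_fromBlocks₁₁, trace_sub, Complex.sub_re]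
    simp only [trace, diag_apply, Matrix.map_apply, Complex.re_sum, Complex.ofReal_re]
  have hcorner : (∑ s, ((1 - net.b s : ℝ) : ℂ) • (net.crlbBlock x s).toBlocks₁₁).PosSemidef := by
    convert hx.C2c.submatrix Sum.inl
    ext i j
    simp only [toBlocks₁₁, of_apply, submatrix_apply, Matrix.sum_apply, Matrix.smul_apply]
  have hnonneg : 0 ≤ ∑ s, (1 - net.b s) * ((net.Fpp x s).trace - x.J.trace.re) := by
    simpa only [trace_sum, trace_smul, smul_eq_mul, map_sum, re_eq_complex_re,
      Complex.re_ofReal_mul, htrace] using re_trace_nonneg hcorner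
  simpa only [mul_sub, Finset.sum_sub_distrib, ← Finset.sum_mul, hb_sum, one_mul, sub_nonneg]
    using hnonneg

theorem exists_mulVec_ne_zero (hx : net.RelaxedFeasible 𝒜 x) {k : Fin K} (hσc : net.σc k ≠ 0)
    (hb : ∀ s, 0 ≤ net.b s) : ∃ s, x.Wt s k *ᵥ net.h s k ≠ 0 := by
  by_contra! hzero
  have hsignal (s) : net.rxPower s k (x.Wt s k) = 0 := by
    rw [rxPower_eq_re_dotProduct, hzero s, dotProduct_zero, Complex.zero_re]
  have hsensing : 0 ≤ ∑ s, net.b s * net.rxPower s k (x.R s) :=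
    Finset.sum_nonneg fun s _ => mul_nonneg (hb s) (rxPower_nonneg (hx.R_psd s) s k)
  have hinterference : 0 ≤ ∑ s, ∑ k' ∈ Finset.univ.erase k, net.rxPower s k (x.Wt s k') :=
    Finset.sum_nonneg fun s _ => Finset.sum_nonneg fun k' _ => rxPower_nonneg (hx.C10d s k') s k
  have hC3 : net.σc k ^ 2 ≤ 1 / net.Γ k * ∑ s, net.rxPower s k (x.Wt s k)
      - ∑ s, net.b s * net.rxPower s k (x.R s)
      - ∑ s, ∑ k' ∈ Finset.univ.erase k, net.rxPower s k (x.Wt s k') := hx.C3 k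
  simp only [hsignal, Finset.sum_const_zero, mul_zero] at hC3
  linarith [sq_pos_of_ne_zero hσc]

theorem P_mul_N_pos (hx : net.RelaxedFeasible 𝒜 x) {k : Fin K} (hσc : net.σc k ≠ 0)
    (hb : ∀ s, 0 ≤ net.b s) : 0 < net.P * N := by
  obtain ⟨s, hs⟩ := hx.exists_mulVec_ne_zero hσc hb
  have hWt : x.Wt s k ≠ 0 := fun h => hs (by rw [h, zero_mulVec])
  exact (re_trace_pos (hx.C10d s k) hWt).trans_le (hx.trace_Wt_le s k)

theorem a_nonneg (hx : net.RelaxedFeasible 𝒜 x) (s : Fin (M + 1)) {k : Fin K}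
    (hσc : net.σc k ≠ 0) (hb : ∀ s, 0 ≤ net.b s) : 0 ≤ x.a s k :=
  nonneg_of_mul_nonneg_left ((re_trace_nonneg (hx.C10d s k)).trans (hx.trace_Wt_le_a_mul s k))
    (hx.P_mul_N_pos hσc hb)

theorem a_pos (hx : net.RelaxedFeasible 𝒜 x) {s : Fin (M + 1)} {k : Fin K}
    (hσc : net.σc k ≠ 0) (hb : ∀ s, 0 ≤ net.b s) (hWt : x.Wt s k ≠ 0) : 0 < x.a s k :=
  pos_of_mul_pos_left ((re_trace_pos (hx.C10d s k) hWt).trans_le (hx.trace_Wt_le_a_mul s k))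
    (hx.P_mul_N_pos hσc hb).le

theorem a_lt_one (hx : net.RelaxedFeasible 𝒜 x) {s : Fin (M + 1)} {k : Fin K}
    (hσc : net.σc k ≠ 0) (hb : ∀ s, 0 ≤ net.b s) (hs : x.Wt s k *ᵥ net.h s k = 0) :
    x.a s k < 1 := by
  obtain ⟨s₀, hs₀⟩ := hx.exists_mulVec_ne_zero hσc hb
  have hWt : x.Wt s₀ k ≠ 0 := fun h => hs₀ (by rw [h, zero_mulVec])
  have hne : s₀ ≠ s := fun h => hs₀ (h ▸ hs)
  calc x.a s k < ∑ s, x.a s k :=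
        Finset.single_lt_sum hne (Finset.mem_univ s) (Finset.mem_univ s₀) (hx.a_pos hσc hb hWt)
          fun s _ _ => hx.a_nonneg s hσc hb
    _ = 1 := hx.C4 k

end RelaxedFeasible

theorem crlbBlock_congr {x y : Vars M K N} {s : Fin (M + 1)} (hJ : x.J = y.J)
    (hcov : ∀ s' ≠ s, cov x s' = cov y s') : net.crlbBlock x s = net.crlbBlock y s := by
  have hcov' (m : Fin M) : cov x (s.succAbove m) = cov y (s.succAbove m) :=
    hcov _ (s.succAbove_ne m)
  simp only [crlbBlock, Fpp, Fpα, Fαα, D, hcov', hJ]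

-- A BS with `b s = 0` has all the receiving weight, so no other receiver sees its covariance.
theorem sum_crlbBlock_congr (hb : ∀ s, net.b s ≤ 1) (hb_sum : ∑ s, (1 - net.b s) = 1)
    {x y : Vars M K N} (hJ : x.J = y.J) (hcov : ∀ s, net.b s ≠ 0 → cov x s = cov y s) :
    ∑ s, ((1 - net.b s : ℝ) : ℂ) • net.crlbBlock x s =
      ∑ s, ((1 - net.b s : ℝ) : ℂ) • net.crlbBlock y s := by
  refine Finset.sum_congr rfl fun s _ => ?_
  rcases (hb s).eq_or_lt with hbs | hbs
  · rw [hbs, sub_self, Complex.ofReal_zero, zero_smul, zero_smul]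
  rw [crlbBlock_congr hJ]
  refine fun s' hs' => hcov s' fun hbs' => ?_
  have hpair := Finset.add_le_sum (s := Finset.univ) (f := fun s => 1 - net.b s)
    (fun i _ => sub_nonneg.2 (hb i)) (Finset.mem_univ s') (Finset.mem_univ s) hs'
  linarith

variable (net) in
/-- The variables `x` with the sensing signal of the purely receiving BSs switched off. The
constraints leave this signal unbounded, and nothing depends on it. -/
noncomputable def muteReceivers (x : Vars M K N) : Vars M K N :=
  { x with R := fun s => if net.b s = 0 then 0 else x.R s }

theorem muteReceivers_R_of_eq_zero {s : Fin (M + 1)} (hs : net.b s = 0) :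
    (net.muteReceivers x).R s = 0 :=
  if_pos hs

theorem muteReceivers_R_of_ne_zero {s : Fin (M + 1)} (hs : net.b s ≠ 0) :
    (net.muteReceivers x).R s = x.R s :=
  if_neg hs

theorem b_mul_map_muteReceivers_R (φ : Matrix (Fin N) (Fin N) ℂ →+ ℝ) (s : Fin (M + 1)) :
    net.b s * φ ((net.muteReceivers x).R s) = net.b s * φ (x.R s) := by
  by_cases hs : net.b s = 0
  · rw [hs, zero_mul, zero_mul]
  · rw [muteReceivers_R_of_ne_zero hs]

theorem objective_muteReceivers : net.objective (net.muteReceivers x) = net.objective x := by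
  have hR (s) : net.b s * ((net.muteReceivers x).R s).trace.re = net.b s * (x.R s).trace.re :=
    b_mul_map_muteReceivers_R (txPower N) s
  simp only [objective, hR]
  rfl

theorem RelaxedFeasible.muteReceivers (hx : net.RelaxedFeasible 𝒜 x) (hb : ∀ s, net.b s ≤ 1)
    (hb_sum : ∑ s, (1 - net.b s) = 1) : net.RelaxedFeasible 𝒜 (net.muteReceivers x) where
  W_psd := hx.W_psd
  R_psd s := by
    by_cases hs : net.b s = 0
    · rw [muteReceivers_R_of_eq_zero hs]
      exact .zero
    · rw [muteReceivers_R_of_ne_zero hs]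
      exact hx.R_psd s
  C1 s := (congrArg _ (b_mul_map_muteReceivers_R (txPower N) s)).trans_le (hx.C1 s)
  C2a := hx.C2a
  C2b := hx.C2b
  C2c := by
    rw [sum_crlbBlock_congr (x := net.muteReceivers x) (y := x) hb hb_sum rfl]
    · exact hx.C2c
    · intro s hs
      rw [cov, muteReceivers_R_of_ne_zero hs]
      rfl
  C3 k := by
    have hR (s) : net.b s * (net.H s k * (net.muteReceivers x).R s).trace.re =
        net.b s * (net.H s k * x.R s).trace.re := b_mul_map_muteReceivers_R (net.rxPower s k) s
    simp only [hR]
    exact hx.C3 k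
  C4 := hx.C4
  C6 := hx.C6
  C7 := hx.C7
  C10a := hx.C10a
  C10b := hx.C10b
  C10c := hx.C10c
  C10d := hx.C10d

variable (net) in
/-- The variables obtained from `x` by cutting each `W̃_{s,k}` down to the rank-one part that user
`k` sees and transmitting the remainder as sensing signal, with beamformers `W` still to be
chosen. -/
noncomputable def concentrate (x : Vars M K N)
    (W : Fin (M + 1) → Fin K → Matrix (Fin N) (Fin N) ℂ) : Vars M K N where
  W := W
  Wt s k := rankOneAlong (x.Wt s k) (net.h s k)
  R s := x.R s + ∑ k, (x.Wt s k - rankOneAlong (x.Wt s k) (net.h s k))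
  J := x.J
  a := x.a

section Concentrate

variable {W : Fin (M + 1) → Fin K → Matrix (Fin N) (Fin N) ℂ}

theorem cov_concentrate (s : Fin (M + 1)) : cov (net.concentrate x W) s = cov x s := by
  simp only [cov, concentrate, Finset.sum_sub_distrib]
  abel

namespace RelaxedFeasible

theorem rxPower_concentrate_Wt (hx : net.RelaxedFeasible 𝒜 x) (s : Fin (M + 1)) (k : Fin K) :
    net.rxPower s k ((net.concentrate x W).Wt s k) = net.rxPower s k (x.Wt s k) := by
  rw [rxPower_eq_re_dotProduct, rxPower_eq_re_dotProduct, concentrate,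
    dotProduct_rankOneAlong_mulVec (hx.C10d s k).isHermitian]

theorem posSemidef_sub_concentrate_Wt (hx : net.RelaxedFeasible 𝒜 x) (s : Fin (M + 1))
    (k : Fin K) : (x.Wt s k - (net.concentrate x W).Wt s k).PosSemidef :=
  posSemidef_sub_rankOneAlong (hx.C10d s k) (net.h s k)

theorem txPower_concentrate_le (hx : net.RelaxedFeasible 𝒜 x) (hb : ∀ s, net.b s ≤ 1)
    (s : Fin (M + 1)) :
    ∑ k, ((net.concentrate x W).Wt s k).trace.re +
        net.b s * ((net.concentrate x W).R s).trace.re ≤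
      ∑ k, (x.Wt s k).trace.re + net.b s * (x.R s).trace.re :=
  sum_add_mul_map_add_sum_sub_le (txPower N) (hb s) (x.R s)
    (fun k _ => re_trace_mono (hx.posSemidef_sub_concentrate_Wt s k))
    fun k hk => absurd (Finset.mem_univ k) hk

theorem interference_concentrate_le (hx : net.RelaxedFeasible 𝒜 x) (hb : ∀ s, net.b s ≤ 1)
    (s : Fin (M + 1)) (k : Fin K) :
    ∑ k' ∈ Finset.univ.erase k, net.rxPower s k ((net.concentrate x W).Wt s k') +
        net.b s * net.rxPower s k ((net.concentrate x W).R s) ≤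
      ∑ k' ∈ Finset.univ.erase k, net.rxPower s k (x.Wt s k') +
        net.b s * net.rxPower s k (x.R s) := by
  refine sum_add_mul_map_add_sum_sub_le (net.rxPower s k) (hb s) (x.R s)
    (fun k' _ => rxPower_mono (hx.posSemidef_sub_concentrate_Wt s k') s k) fun k' hk' => ?_
  obtain rfl : k' = k := by simpa using hk'
  exact hx.rxPower_concentrate_Wt s k'

theorem objective_concentrate_le (hx : net.RelaxedFeasible 𝒜 x) (hb : ∀ s, net.b s ≤ 1) :
    net.objective (net.concentrate x W) ≤ net.objective x := by
  unfold objective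
  rw [← Finset.sum_add_distrib, ← Finset.sum_add_distrib]
  exact add_le_add_left (Finset.sum_le_sum fun s _ => hx.txPower_concentrate_le hb s) _

theorem C3_concentrate (hx : net.RelaxedFeasible 𝒜 x) (hb : ∀ s, net.b s ≤ 1) (k : Fin K) :
    net.σc k ^ 2 ≤
      1 / net.Γ k * ∑ s, net.rxPower s k ((net.concentrate x W).Wt s k)
      - ∑ s, net.b s * net.rxPower s k ((net.concentrate x W).R s)
      - ∑ s, ∑ k' ∈ Finset.univ.erase k, net.rxPower s k ((net.concentrate x W).Wt s k') := by
  have hinterference := Finset.sum_le_sum fun s (_ : s ∈ Finset.univ) =>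
    hx.interference_concentrate_le (W := W) hb s k
  have hC3 : net.σc k ^ 2 ≤ 1 / net.Γ k * ∑ s, net.rxPower s k (x.Wt s k)
      - ∑ s, net.b s * net.rxPower s k (x.R s)
      - ∑ s, ∑ k' ∈ Finset.univ.erase k, net.rxPower s k (x.Wt s k') := hx.C3 k
  simp only [Finset.sum_add_distrib] at hinterference
  simp only [hx.rxPower_concentrate_Wt]
  linarith

theorem concentrate (hx : net.RelaxedFeasible 𝒜 x) (hb : ∀ s, net.b s ≤ 1)
    (hb_sum : ∑ s, (1 - net.b s) = 1) (hW : ∀ s k, (W s k).PosSemidef)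
    (hle : ∀ s k, (W s k - (net.concentrate x W).Wt s k).PosSemidef)
    (hge : ∀ s k, ((net.concentrate x W).Wt s k - (W s k -
      (((1 - x.a s k) * net.P : ℝ) : ℂ) • (1 : Matrix (Fin N) (Fin N) ℂ))).PosSemidef) :
    net.RelaxedFeasible 𝒜 (net.concentrate x W) where
  W_psd := hW
  R_psd s :=
    (hx.R_psd s).add (posSemidef_sum _ fun k _ => hx.posSemidef_sub_concentrate_Wt (W := W) s k)
  C1 s := (hx.txPower_concentrate_le hb s).trans (hx.C1 s)
  C2a := hx.C2a
  C2b := hx.C2b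
  C2c := by
    rw [sum_crlbBlock_congr (x := net.concentrate x W) (y := x) hb hb_sum rfl fun s _ =>
      cov_concentrate s]
    exact hx.C2c
  C3 := hx.C3_concentrate hb
  C4 := hx.C4
  C6 := hx.C6
  C7 := hx.C7
  C10a s k := by
    have h := (hx.C10a s k).add (hx.posSemidef_sub_concentrate_Wt (W := W) s k)
    rwa [sub_add_sub_cancel] at h
  C10b := hge
  C10c := hle
  C10d s k := posSemidef_rankOneAlong (hx.C10d s k) (net.h s k)

theorem exists_rank_eq_one_beamformer (hx : net.RelaxedFeasible 𝒜 x) (s : Fin (M + 1)) {k : Fin K}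
    (hσc : net.σc k ≠ 0) (hb : ∀ s, net.b s ∈ Set.Icc (0 : ℝ) 1) :
    ∃ W : Matrix (Fin N) (Fin N) ℂ, W.PosSemidef ∧ W.rank = 1 ∧
      (W - rankOneAlong (x.Wt s k) (net.h s k)).PosSemidef ∧
      (rankOneAlong (x.Wt s k) (net.h s k) - (W -
        (((1 - x.a s k) * net.P : ℝ) : ℂ) • (1 : Matrix (Fin N) (Fin N) ℂ))).PosSemidef := by
  have hb0 (s) : 0 ≤ net.b s := (hb s).1
  have hPN := hx.P_mul_N_pos hσc hb0
  have hP : 0 < net.P := pos_of_mul_pos_left hPN (Nat.cast_nonneg N)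
  by_cases hs : x.Wt s k *ᵥ net.h s k = 0
  · have : NeZero N := ⟨Nat.cast_ne_zero.1 (right_ne_zero_of_mul hPN.ne')⟩
    have hc : 0 < (1 - x.a s k) * net.P := mul_pos (sub_pos.2 (hx.a_lt_one hσc hb0 hs)) hP
    obtain ⟨W, hW, hrank, hle⟩ := exists_posSemidef_rank_eq_one_le_smul_one (n := Fin N)
      (Complex.zero_lt_real.2 hc)
    refine ⟨W, hW, hrank, ?_, ?_⟩
    · rwa [rankOneAlong_of_mulVec_eq_zero hs, sub_zero]
    · rwa [rankOneAlong_of_mulVec_eq_zero hs, zero_sub, neg_sub]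
  · have hc : 0 ≤ (1 - x.a s k) * net.P :=
      mul_nonneg (sub_nonneg.2 ((hx.C6 s k).trans (hb s).2)) hP.le
    refine ⟨_, posSemidef_rankOneAlong (hx.C10d s k) _, rank_rankOneAlong (hx.C10d s k) hs, ?_, ?_⟩
    · rw [sub_self]
      exact .zero
    · rw [sub_sub_cancel]
      exact posSemidef_ofReal_smul_one hc N

theorem exists_rank_eq_one (hx : net.RelaxedFeasible 𝒜 x) (hσc : ∀ k, net.σc k ≠ 0)
    (hb : ∀ s, net.b s ∈ Set.Icc (0 : ℝ) 1) (hb_sum : ∑ s, (1 - net.b s) = 1) :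
    ∃ y, net.RelaxedFeasible 𝒜 y ∧ net.objective y ≤ net.objective x ∧
      ∀ s k, (y.W s k).rank = 1 := by
  choose W hW hrank hle hge using fun s k => hx.exists_rank_eq_one_beamformer s (hσc k) hb
  exact ⟨net.concentrate x W, hx.concentrate (fun s => (hb s).2) hb_sum hW hle hge,
    hx.objective_concentrate_le fun s => (hb s).2, hrank⟩

end RelaxedFeasible

end Concentrate

end Network

namespace Vars

variable {M K N : ℕ}

/-- The optimization variables as a tuple; this identification gives `Vars` its topology. -/
def equivProd : Vars M K N ≃
    (Fin (M + 1) → Fin K → Matrix (Fin N) (Fin N) ℂ) ×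
    (Fin (M + 1) → Fin K → Matrix (Fin N) (Fin N) ℂ) ×
    (Fin (M + 1) → Matrix (Fin N) (Fin N) ℂ) ×
    Matrix (Fin 2) (Fin 2) ℂ × (Fin (M + 1) → Fin K → ℝ) where
  toFun x := (x.W, x.Wt, x.R, x.J, x.a)
  invFun e := ⟨e.1, e.2.1, e.2.2.1, e.2.2.2.1, e.2.2.2.2⟩

noncomputable instance : TopologicalSpace (Vars M K N) := .induced equivProd inferInstance

theorem continuous_equivProd : Continuous (equivProd : Vars M K N → _) :=
  continuous_induced_dom

@[fun_prop]
theorem continuous_W (s : Fin (M + 1)) (k : Fin K) : Continuous fun x : Vars M K N => x.W s k :=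
  (continuous_apply_apply s k).comp continuous_equivProd.fst

@[fun_prop]
theorem continuous_Wt (s : Fin (M + 1)) (k : Fin K) : Continuous fun x : Vars M K N => x.Wt s k :=
  (continuous_apply_apply s k).comp continuous_equivProd.snd.fst

@[fun_prop]
theorem continuous_R (s : Fin (M + 1)) : Continuous fun x : Vars M K N => x.R s :=
  (continuous_apply s).comp continuous_equivProd.snd.snd.fst

@[fun_prop]
theorem continuous_J : Continuous fun x : Vars M K N => x.J :=
  continuous_equivProd.snd.snd.snd.fst

@[fun_prop]
theorem continuous_a (s : Fin (M + 1)) (k : Fin K) : Continuous fun x : Vars M K N => x.a s k :=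
  (continuous_apply_apply s k).comp continuous_equivProd.snd.snd.snd.snd

end Vars

namespace Network

variable {M K N : ℕ} (net : Network M K N) (s : Fin (M + 1))

@[fun_prop]
theorem continuous_cov : Continuous fun x : Vars M K N => cov x s := by
  unfold cov
  fun_prop

@[fun_prop]
theorem continuous_Fpp : Continuous fun x => net.Fpp x s :=
  continuous_matrix fun i j => by
    simp only [Fpp, of_apply]
    fun_prop

@[fun_prop]
theorem continuous_D : Continuous fun x => net.D x s :=
  continuous_matrix fun i m => by
    simp only [D, of_apply]
    fun_prop

@[fun_prop]
theorem continuous_Fpα : Continuous fun x => net.Fpα x s :=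
  continuous_matrix fun i cm => by
    simp only [Fpα, of_apply]
    fun_prop

@[fun_prop]
theorem continuous_Fαα : Continuous fun x => net.Fαα x s :=
  continuous_matrix fun cm cm' => by
    simp only [Fαα, Matrix.smul_apply, kroneckerMap_apply, diagonal_apply]
    split_ifs <;> fun_prop

@[fun_prop]
theorem continuous_crlbBlock : Continuous fun x => net.crlbBlock x s :=
  .matrix_fromBlocks (((net.continuous_Fpp s).matrix_map Complex.continuous_ofReal).sub
      Vars.continuous_J)
    ((net.continuous_Fpα s).matrix_map Complex.continuous_ofReal)
    ((net.continuous_Fpα s).matrix_transpose.matrix_map Complex.continuous_ofReal)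
    ((net.continuous_Fαα s).matrix_map Complex.continuous_ofReal)

@[fun_prop]
theorem continuous_objective : Continuous net.objective := by
  unfold objective
  fun_prop

/-- The relaxed feasible points whose purely receiving BSs are silent. -/
def mutedSet (𝒜 : Set ℝ) : Set (Vars M K N) :=
  {x | net.RelaxedFeasible 𝒜 x ∧ ∀ s, net.b s = 0 → x.R s = 0}

variable {net} {𝒜 : Set ℝ}

theorem isClosed_mutedSet (h𝒜 : IsClosed 𝒜) : IsClosed (net.mutedSet 𝒜) := by
  refine isClosed_of_closure_subset fun x hx => ?_
  have hlim {S : Set (Vars M K N)} (hS : IsClosed S) (hsub : ∀ y ∈ net.mutedSet 𝒜, y ∈ S) :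
      x ∈ S := closure_minimal hsub hS hx
  have hpsd {n : Type} [Fintype n] {f : Vars M K N → Matrix n n ℂ} (hf : Continuous f)
      (hsub : ∀ y ∈ net.mutedSet 𝒜, (f y).PosSemidef) : (f x).PosSemidef :=
    hlim (isClosed_setOf_posSemidef.preimage hf) hsub
  have hle {f g : Vars M K N → ℝ} (hf : Continuous f) (hg : Continuous g)
      (hsub : ∀ y ∈ net.mutedSet 𝒜, f y ≤ g y) : f x ≤ g x :=
    hlim (isClosed_le hf hg) hsub
  have hJ : x.J.PosSemidef ∧ IsUnit x.J.det ∧ (x.J⁻¹).trace.re ≤ net.ε :=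
    hlim ((isClosed_setOf_posSemidef_re_trace_inv_le net.ε).preimage Vars.continuous_J)
      fun y hy => ⟨hy.1.C2b, hy.1.C2a⟩
  exact
    ⟨{ W_psd := fun s k => hpsd (by fun_prop) fun y hy => hy.1.W_psd s k
       R_psd := fun s => hpsd (by fun_prop) fun y hy => hy.1.R_psd s
       C1 := fun s => hle (by fun_prop) continuous_const fun y hy => hy.1.C1 s
       C2a := hJ.2
       C2b := hJ.1
       C2c := hpsd (by fun_prop) fun y hy => hy.1.C2c
       C3 := fun k => hle continuous_const (by fun_prop) fun y hy => hy.1.C3 k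
       C4 := fun k => hlim (isClosed_eq (by fun_prop) continuous_const) fun y hy => hy.1.C4 k
       C6 := fun s k => hle (by fun_prop) continuous_const fun y hy => hy.1.C6 s k
       C7 := fun s k => hlim (h𝒜.preimage (Vars.continuous_a s k)) fun y hy => hy.1.C7 s k
       C10a := fun s k => hpsd (by fun_prop) fun y hy => hy.1.C10a s k
       C10b := fun s k => hpsd (by fun_prop) fun y hy => hy.1.C10b s k
       C10c := fun s k => hpsd (by fun_prop) fun y hy => hy.1.C10c s k
       C10d := fun s k => hpsd (by fun_prop) fun y hy => hy.1.C10d s k },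
      fun s hs => hlim (isClosed_eq (by fun_prop) continuous_const) fun y hy => hy.2 s hs⟩

variable (net) in
/-- A compact box that contains the muted feasible points, once `c` bounds the trace of `J`. For
`b s = 0` the bound on the trace of `R_s` reads `0`, because `P / 0 = 0`. -/
def box (c : ℝ) : Set (Vars M K N) :=
  {x | (∀ s k, x.W s k ∈ psdTraceLE ℂ (Fin N) (net.P * N)) ∧
    (∀ s k, x.Wt s k ∈ psdTraceLE ℂ (Fin N) (net.P * N)) ∧
    (∀ s, x.R s ∈ psdTraceLE ℂ (Fin N) (net.P / net.b s)) ∧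
    x.J ∈ psdTraceLE ℂ (Fin 2) c ∧
    ∀ s k, x.a s k ∈ Set.Icc 0 1}

variable (net) in
theorem isCompact_box (c : ℝ) : IsCompact (net.box c) := by
  have hprod :=
    (isCompact_univ_pi fun _ : Fin (M + 1) => isCompact_univ_pi fun _ : Fin K =>
      isCompact_psdTraceLE (𝕜 := ℂ) (n := Fin N) (net.P * N)).prod <|
    (isCompact_univ_pi fun _ : Fin (M + 1) => isCompact_univ_pi fun _ : Fin K =>
      isCompact_psdTraceLE (𝕜 := ℂ) (n := Fin N) (net.P * N)).prod <|
    (isCompact_univ_pi fun s : Fin (M + 1) =>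
      isCompact_psdTraceLE (𝕜 := ℂ) (n := Fin N) (net.P / net.b s)).prod <|
    (isCompact_psdTraceLE (𝕜 := ℂ) (n := Fin 2) c).prod <|
    isCompact_univ_pi fun _ : Fin (M + 1) => isCompact_univ_pi fun _ : Fin K =>
      isCompact_Icc (a := (0 : ℝ)) (b := 1)
  have hpreimage := (Vars.equivProd.toHomeomorphOfIsInducing ⟨rfl⟩).isCompact_preimage.2 hprod
  simp only [Set.preimage, Set.mem_prod, Set.mem_univ_pi] at hpreimage
  exact hpreimage

theorem RelaxedFeasible.mem_box {x : Vars M K N} (hx : net.RelaxedFeasible 𝒜 x)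
    (hR : ∀ s, net.b s = 0 → x.R s = 0) (hσc : ∀ k, net.σc k ≠ 0)
    (hb : ∀ s, net.b s ∈ Set.Icc (0 : ℝ) 1) {c : ℝ} (hJ : x.J.trace.re ≤ c) : x ∈ net.box c := by
  refine ⟨fun s k => ⟨hx.W_psd s k, hx.trace_W_le s k⟩,
    fun s k => ⟨hx.C10d s k, hx.trace_Wt_le s k⟩, fun s => ⟨hx.R_psd s, ?_⟩, ⟨hx.C2b, hJ⟩,
    fun s k => ⟨hx.a_nonneg s (hσc k) fun s => (hb s).1, (hx.C6 s k).trans (hb s).2⟩⟩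
  rcases (hb s).1.eq_or_lt' with hs | hs
  · simp [hR s hs, hs]
  · exact hx.trace_R_le hs

theorem isCompact_mutedSet (h𝒜 : IsClosed 𝒜) (hσc : ∀ k, net.σc k ≠ 0)
    (hb : ∀ s, net.b s ∈ Set.Icc (0 : ℝ) 1) (hb_sum : ∑ s, (1 - net.b s) = 1) :
    IsCompact (net.mutedSet 𝒜) := by
  have hFpp : Continuous fun x => ∑ s, (1 - net.b s) * (net.Fpp x s).trace := by fun_prop
  obtain ⟨c, hc⟩ := ((net.isCompact_box 0).image hFpp).bddAbove
  refine (net.isCompact_box c).of_isClosed_subset (isClosed_mutedSet h𝒜) fun x ⟨hx, hR⟩ => ?_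
  obtain ⟨hW, hWt, hRbox, -, ha⟩ := hx.mem_box hR hσc hb le_rfl
  -- `Fpp` does not involve `J`, so it can be bounded before `J` is.
  have hbound : ∑ s, (1 - net.b s) * (net.Fpp x s).trace ≤ c :=
    hc ⟨{ x with J := 0 }, ⟨hW, hWt, hRbox, zero_mem_psdTraceLE_zero, ha⟩, rfl⟩
  exact hx.mem_box hR hσc hb ((hx.trace_J_le hb_sum).trans hbound)

theorem exists_isMinOn_relaxedSet (h𝒜 : IsClosed 𝒜) (hσc : ∀ k, net.σc k ≠ 0)
    (hb : ∀ s, net.b s ∈ Set.Icc (0 : ℝ) 1) (hb_sum : ∑ s, (1 - net.b s) = 1)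
    (hfeas : (net.relaxedSet 𝒜).Nonempty) :
    ∃ x ∈ net.relaxedSet 𝒜, IsMinOn net.objective (net.relaxedSet 𝒜) x := by
  have hmute {x : Vars M K N} (hx : x ∈ net.relaxedSet 𝒜) : net.muteReceivers x ∈ net.mutedSet 𝒜 :=
    ⟨hx.muteReceivers (fun s => (hb s).2) hb_sum, fun _ => muteReceivers_R_of_eq_zero⟩
  obtain ⟨x₀, hx₀⟩ := hfeas
  obtain ⟨x, hx, hmin⟩ := (isCompact_mutedSet h𝒜 hσc hb hb_sum).exists_isMinOn
    ⟨_, hmute hx₀⟩ net.continuous_objective.continuousOn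
  exact ⟨x, hx.1, fun y hy => (hmin (hmute hy)).trans_eq objective_muteReceivers⟩

end Network

end ISAC

theorem theorem1_general {M K N : ℕ} (net : ISAC.Network M K N) (𝒜 : Set ℝ)
    (h𝒜 : IsClosed 𝒜)
    (hσc : ∀ k, net.σc k ≠ 0) (hσr : ∀ s, net.σr s ≠ 0) (hΓ : ∀ k, net.Γ k ≠ 0)
    (hθr : ∀ s, DifferentiableAt ℝ (net.θr s) net.p)
    (hθt : ∀ s, DifferentiableAt ℝ (net.θt s) net.p)
    (hτ : ∀ s s', DifferentiableAt ℝ (net.τ s s') net.p)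
    (hb : ∀ s, net.b s ∈ Set.Icc (0 : ℝ) 1) (hb_sum : ∑ s, (1 - net.b s) = 1)
    (hfeas : (net.relaxedSet 𝒜).Nonempty) :
    ∃ x ∈ net.relaxedSet 𝒜,
      IsMinOn net.objective (net.relaxedSet 𝒜) x ∧
      (∀ s k, (x.W s k).rank = 1) ∧
      x ∈ net.rankSet 𝒜 ∧ IsMinOn net.objective (net.rankSet 𝒜) x := by
  obtain ⟨x, hx, hmin⟩ := ISAC.Network.exists_isMinOn_relaxedSet h𝒜 hσc hb hb_sum hfeas
  obtain ⟨y, hy, hle, hrank⟩ :=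
    ISAC.Network.RelaxedFeasible.exists_rank_eq_one hx hσc hb hb_sum
  have hymin : IsMinOn net.objective (net.relaxedSet 𝒜) y := fun z hz => hle.trans (hmin hz)
  exact ⟨y, hy, hymin, hrank, ⟨hy, fun s k => (hrank s k).le⟩, hymin.on_subset fun z hz => hz.1⟩

theorem theorem1 {M K N : ℕ} (net : ISAC.Network M K N) (𝒜 : Set ℝ)
    (h𝒜 : 𝒜 = {0, 1} ∨ 𝒜 = Set.Icc 0 1)
    (hσc : ∀ k, 0 < net.σc k) (hσr : ∀ s, 0 < net.σr s) (hΓ : ∀ k, 0 < net.Γ k)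
    (hθr : ∀ s, DifferentiableAt ℝ (net.θr s) net.p)
    (hθt : ∀ s, DifferentiableAt ℝ (net.θt s) net.p)
    (hτ : ∀ s s', DifferentiableAt ℝ (net.τ s s') net.p)
    (hb : ∀ s, net.b s ∈ Set.Icc (0 : ℝ) 1) (hb_sum : ∑ s, (1 - net.b s) = 1)
    (hfeas : (net.relaxedSet 𝒜).Nonempty) :
    ∃ x ∈ net.relaxedSet 𝒜,
      IsMinOn net.objective (net.relaxedSet 𝒜) x ∧
      (∀ s k, (x.W s k).rank = 1) ∧
      x ∈ net.rankSet 𝒜 ∧ IsMinOn net.objective (net.rankSet 𝒜) x := by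
  have hclosed : IsClosed 𝒜 :=
    h𝒜.elim (fun h => h ▸ (Set.toFinite _).isClosed) fun h => h ▸ isClosed_Icc
  exact theorem1_general net 𝒜 hclosed (fun k => (hσc k).ne') (fun s => (hσr s).ne')
    (fun k => (hΓ k).ne') hθr hθt hτ hb hb_sum hfeas
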